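/- Let $v$ and $k$ be positive integers. A \emph{symmetric $(v,k,1)$-covering} is a pair $(V,\mathcal B)$ in which $V$ is a set of $v$ points and $\mathcal B$ is a collection of exactly $v$ $k$-subsets of $V$ (blocks) such that every pair of distinct points of $V$ is contained in at least one block. Its \emph{excess} is the multigraph with vertex set $V$ in which, for distinct $x,y\in V$, the edge $xy$ has multiplicity $r_{xy}-1$, where $r_{xy}$ is the number of blocks containing both $x$ and $y$. A pair of parallel edges is regarded as a $2$-cycle. If $k$ is a positive integer such that $k\equiv 8, 48, 68$ or $88 \pmod{100}$ and $v=k(k-1)-1$, then there does not exist a symmetric $(v,k,1)$-covering whose excess is a vertex-disjoint union of cycles, covering all points, each of which has length $2$ or $3$. -/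

import Mathlib

/-- A loopless multigraph with vertex set `V`: `mult x y` is the multiplicity of the edge
joining `x` and `y`. -/
structure LooplessMultigraph (V : Type*) where
  mult : V → V → ℕ
  symm : ∀ x y, mult x y = mult y x
  loopless : ∀ x, mult x x = 0

namespace LooplessMultigraph

/-- The cycle of length `n` (for `n ≥ 2`), with vertices `0, 1, …, n - 1` in cyclic order.
The two summands count the steps from `x` to `y` and from `y` to `x`; for `n = 2` both are
present, so that the cycle of length two is a pair of parallel edges. -/
def cycle (n : ℕ) : LooplessMultigraph (Fin n) where
  mult x y :=
    if x = y then 0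
    else (if (x.val + 1) % n = y.val then 1 else 0) + (if (y.val + 1) % n = x.val then 1 else 0)
  symm x y := by
    by_cases h : x = y
    · simp [h]
    · simp [h, Ne.symm h, add_comm]
  loopless x := by simp

/-- The vertex-disjoint union of cycles of lengths `c 0, …, c (t - 1)`: the vertex `⟨i, a⟩` is
the `a`-th vertex of the `i`-th cycle. -/
def disjointCycles {t : ℕ} (c : Fin t → ℕ) : LooplessMultigraph (Σ i : Fin t, Fin (c i)) where
  mult p q := if h : p.1 = q.1 then (cycle (c q.1)).mult (Fin.cast (congrArg c h) p.2) q.2 else 0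
  symm := by
    rintro ⟨i, a⟩ ⟨j, b⟩
    by_cases h : i = j
    · subst h
      simpa using (cycle (c i)).symm a b
    · simp [h, Ne.symm h]
  loopless := by
    rintro ⟨i, a⟩
    simpa using (cycle (c i)).loopless a

/-- Two multigraphs are isomorphic if some bijection of the vertices preserves all edge
multiplicities. -/
def IsIsomorphic {V W : Type*} (G : LooplessMultigraph V) (H : LooplessMultigraph W) : Prop :=
  ∃ e : V ≃ W, ∀ x y, G.mult x y = H.mult (e x) (e y)

/-- `G` is the vertex-disjoint union of `t` cycles, of lengths `c 0, …, c (t - 1) ≥ 2`, which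
together cover all the vertices. -/
def HasCycleLengths {V : Type*} (G : LooplessMultigraph V) {t : ℕ} (c : Fin t → ℕ) : Prop :=
  (∀ i, 2 ≤ c i) ∧ G.IsIsomorphic (disjointCycles c)

/-- `G` is a vertex-disjoint union of cycles each of which has length 2 or 3. -/
def ConsistsOfTwoAndThreeCycles {V : Type*} (G : LooplessMultigraph V) : Prop :=
  ∃ (t : ℕ) (c : Fin t → ℕ), G.HasCycleLengths c ∧ ∀ i, c i = 2 ∨ c i = 3

end LooplessMultigraph

/-- The number of blocks, counted with multiplicity, that contain both `x` and `y`. -/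
def pairCount {V : Type*} [DecidableEq V] (B : Multiset (Finset V)) (x y : V) : ℕ :=
  B.countP fun b => x ∈ b ∧ y ∈ b

/-- A `(v, k, lam)`-covering with point set `V`: a collection (repetitions allowed) of
`k`-subsets of the `v`-set `V` such that every pair of distinct points lies in at least
`lam` of them. -/
structure PairCovering (V : Type*) [Fintype V] [DecidableEq V] (v k lam : ℕ) where
  card_points : Fintype.card V = v
  blocks : Multiset (Finset V)
  card_block : ∀ b ∈ blocks, b.card = k
  covers : ∀ x y : V, x ≠ y → lam ≤ pairCount blocks x y

namespace PairCovering

variable {V : Type*} [Fintype V] [DecidableEq V] {v k lam : ℕ}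

/-- A covering is symmetric if it has as many blocks as points. -/
def IsSymmetric (C : PairCovering V v k lam) : Prop :=
  C.blocks.card = v

/-- The excess of a covering: distinct points `x` and `y` are joined by `r - lam` edges, where
`r ≥ lam` is the number of blocks that contain both of them. -/
def excess (C : PairCovering V v k lam) : LooplessMultigraph V where
  mult x y := if x = y then 0 else pairCount C.blocks x y - lam
  symm x y := by
    by_cases h : x = y
    · simp [h]
    · simp [h, Ne.symm h, pairCount, and_comm]
  loopless x := by simp

end PairCovering

/-! Every point lies in exactly `k` blocks, so for the incidence matrix `N` (points by blocks) the
product `N Nᵀ` is `M = J + (k - 1) I + A`, where `J` is all ones and `A` is the adjacency matrix of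
the excess. As there are `v` blocks, the form of `M` is a sum of `v` squares over every field of
characteristic zero. The structure of `A` gives another diagonalization. After adding one variable
with coefficient `k + 1`, `exists_diagonalizations` presents a nondegenerate form on a space of
dimension `v + 1` in two ways: as `v` squares plus `k + 1` times a square, and with coefficients
determined by the numbers of 2-cycles and 3-cycles.

Over a suitable `ℚ_p` each presentation becomes `v - 2` squares plus a ternary form. Witt
cancellation would make the ternary remainders equivalent, so one cannot be anisotropic and the
other isotropic; `false_of_anisotropic_of_isotropic` proves this directly. Over `ℚ_5` an odd number
of 2-cycles would give such a conflict, and over `ℚ_2` an even number would. -/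

/-! ### Sums of squares and a substitute for Witt cancellation. -/

section QuadraticCancellation

variable {K V : Type*} [Field K] [AddCommGroup V] [Module K V]

theorem finrank_le_finrank_inf_ker_add_one [FiniteDimensional K V] (U : Submodule K V)
    (G : V →ₗ[K] K) :
    Module.finrank K U ≤ Module.finrank K (U ⊓ LinearMap.ker G : Submodule K V) + 1 := by
  have h1 := Submodule.finrank_sup_add_finrank_inf_eq U (LinearMap.ker G)
  have h2 := Submodule.finrank_le (U ⊔ LinearMap.ker G)
  have h3 := G.finrank_range_add_finrank_ker
  have h4 := Submodule.finrank_le (LinearMap.range G)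
  rw [Module.finrank_self] at h4
  omega

/-- If the functionals `L i` separate the points of `Z`, then a subspace of codimension at most
`r` meets `Z` trivially and satisfies `L i = ± M i` for all `i`. -/
theorem exists_submodule_sq_eq_sq [FiniteDimensional K V] (h2 : (2 : K) ≠ 0) :
    ∀ (r : ℕ) (L M : Fin r → V →ₗ[K] K) (Z : Submodule K V),
      (∀ x ∈ Z, (∀ i, L i x = 0) → x = 0) →
      ∃ U : Submodule K V, Module.finrank K V ≤ Module.finrank K U + r ∧
        (∀ x ∈ U, ∀ i, L i x ^ 2 = M i x ^ 2) ∧ ∀ x ∈ U, x ∈ Z → x = 0 := by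
  intro r
  induction r with
  | zero =>
    intro L M Z hZ
    exact ⟨⊤, by simp, fun x _ i => i.elim0, fun x _ hx => hZ x hx fun i => i.elim0⟩
  | succ r ih =>
    intro L M Z hZ
    obtain ⟨U, hU, hsq, hUZ⟩ := ih (fun i => L i.castSucc) (fun i => M i.castSucc)
      (Z ⊓ LinearMap.ker (L (Fin.last r))) (by
        rintro x ⟨hx, hx0⟩ h
        refine hZ x hx fun i => ?_
        induction i using Fin.lastCases with
        | last => exact hx0
        | cast i => exact h i)
    set l := L (Fin.last r)
    set m := M (Fin.last r)
    -- By the choice of `U`, `l` is injective on `U ⊓ Z`, which is thus at most a line. If `u` spans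
    -- it, `l u ≠ 0` and `2 ≠ 0` prevent `l - m` and `l + m` from both vanishing at `u`; cutting by
    -- one that does not vanish there removes the line.
    obtain ⟨G, hG, hGU⟩ : ∃ G : V →ₗ[K] K, (∀ x, G x = 0 → l x ^ 2 = m x ^ 2) ∧
        ∀ x ∈ U, x ∈ Z → G x = 0 → x = 0 := by
      have hm : ∀ x, (l - m) x = 0 → l x ^ 2 = m x ^ 2 := fun x hx => by
        rw [LinearMap.sub_apply, sub_eq_zero] at hx
        rw [hx]
      have hp : ∀ x, (l + m) x = 0 → l x ^ 2 = m x ^ 2 := fun x hx => by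
        rw [LinearMap.add_apply] at hx
        linear_combination (l x - m x) * hx
      by_cases hu : ∃ u ∈ U, u ∈ Z ∧ u ≠ 0
      · obtain ⟨u, huU, huZ, hu0⟩ := hu
        have hl : l u ≠ 0 := fun h => hu0 (hUZ u huU ⟨huZ, h⟩)
        have key : ∀ G : V →ₗ[K] K, G u ≠ 0 → ∀ x ∈ U, x ∈ Z → G x = 0 → x = 0 := by
          intro G hGu x hxU hxZ hGx
          have hx : x - (l x / l u) • u = 0 := by
            refine hUZ _ (U.sub_mem hxU (U.smul_mem _ huU))
              ⟨Z.sub_mem hxZ (Z.smul_mem _ huZ), ?_⟩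
            simp [l] at hl ⊢
            field_simp
            simp
          have hx' := sub_eq_zero.1 hx
          rw [hx', map_smul, smul_eq_mul] at hGx
          rw [hx', (mul_eq_zero.1 hGx).resolve_right hGu, zero_smul]
        by_cases h : (l - m) u = 0
        · refine ⟨l + m, hp, key _ fun h' => hl ?_⟩
          rw [LinearMap.sub_apply] at h
          rw [LinearMap.add_apply] at h'
          exact (mul_eq_zero.1 (by linear_combination h + h' : (2 : K) * l u = 0)).resolve_left h2
        · exact ⟨l - m, hm, key _ h⟩
      · push Not at hu
        exact ⟨l - m, hm, fun x hx hxZ _ => hu x hx hxZ⟩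
    refine ⟨U ⊓ LinearMap.ker G, ?_, ?_, fun x hx hxZ => hGU x hx.1 hxZ hx.2⟩
    · have := finrank_le_finrank_inf_ker_add_one U G
      omega
    · rintro x ⟨hxU, hxG⟩ i
      induction i using Fin.lastCases with
      | last => exact hG x hxG
      | cast i => exact hsq x hxU i

/-- `f` is a sum of `r` squares of linear functionals. -/
def IsSumOfSquares (K : Type*) {V : Type*} [Field K] [AddCommGroup V] [Module K V]
    (r : ℕ) (f : V → K) : Prop :=
  ∃ M : Fin r → V →ₗ[K] K, ∀ x, f x = ∑ i, M i x ^ 2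

namespace IsSumOfSquares

theorem zero : IsSumOfSquares K 0 (fun _ : V => (0 : K)) :=
  ⟨fun i => i.elim0, fun x => by simp⟩

theorem sq (M : V →ₗ[K] K) : IsSumOfSquares K 1 (fun x => M x ^ 2) :=
  ⟨fun _ => M, fun x => by simp⟩

theorem congr {r : ℕ} {f g : V → K} (hf : IsSumOfSquares K r f) (h : ∀ x, g x = f x) :
    IsSumOfSquares K r g := by
  obtain ⟨M, hM⟩ := hf
  exact ⟨M, fun x => (h x).trans (hM x)⟩

theorem add {r s : ℕ} {f g : V → K} (hf : IsSumOfSquares K r f) (hg : IsSumOfSquares K s g) :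
    IsSumOfSquares K (r + s) (fun x => f x + g x) := by
  obtain ⟨M, hM⟩ := hf
  obtain ⟨N, hN⟩ := hg
  exact ⟨Fin.append M N, fun x => by simp [Fin.sum_univ_add, hM, hN]⟩

theorem exists_of_succ {r : ℕ} {f : V → K} (hf : IsSumOfSquares K (r + 1) f) :
    ∃ (g : V → K) (M : V →ₗ[K] K), IsSumOfSquares K r g ∧ ∀ x, f x = g x + M x ^ 2 := by
  obtain ⟨M, hM⟩ := hf
  exact ⟨_, M (Fin.last r), ⟨fun i => M i.castSucc, fun x => rfl⟩,
    fun x => by rw [hM, Fin.sum_univ_castSucc]⟩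

theorem multiset_sum {ι : Type*} (s : Multiset ι) (T : ι → V →ₗ[K] K) :
    IsSumOfSquares K s.card (fun x => (s.map fun i => T i x ^ 2).sum) := by
  induction s using Multiset.induction_on with
  | empty => simpa using zero
  | cons i s ih => simpa [add_comm] using ih.add (sq (T i))

theorem two_mul {c p q : K} (hc : c = p ^ 2 + q ^ 2) (X Y : V →ₗ[K] K) :
    IsSumOfSquares K 2 (fun x => c * X x ^ 2 + c * Y x ^ 2) :=
  ⟨![p • X + q • Y, q • X - p • Y], fun x => by simp [hc]; ring⟩

/-- Euler's four-square identity, as `two_mul` is the two-square identity: such a factor `c` is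
absorbed by blocks of four squares. -/
theorem four_mul {c p q r s : K} (hc : c = p ^ 2 + q ^ 2 + r ^ 2 + s ^ 2)
    (X Y Z W : V →ₗ[K] K) :
    IsSumOfSquares K 4 (fun x => c * X x ^ 2 + c * Y x ^ 2 + c * Z x ^ 2 + c * W x ^ 2) :=
  ⟨![p • X + q • Y + r • Z + s • W, q • X - p • Y + s • Z - r • W,
      r • X - s • Y - p • Z + q • W, s • X + r • Y - q • Z - p • W],
    fun x => by simp [hc, Fin.sum_univ_four]; ring⟩

theorem even_sum {ι : Type*} {c p q : K} (hc : c = p ^ 2 + q ^ 2)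
    (T : ι → V →ₗ[K] K) : ∀ (j : ℕ) (s : Finset ι), s.card = 2 * j →
      IsSumOfSquares K (2 * j) (fun x => c * ∑ i ∈ s, T i x ^ 2) := by
  classical
  intro j
  induction j with
  | zero =>
    intro s hs
    obtain rfl : s = ∅ := by simpa using hs
    simpa using zero
  | succ j ih =>
    intro s hs
    obtain ⟨u, hus, hu⟩ := Finset.exists_subset_card_eq (show 2 ≤ s.card by omega)
    have h := ih (s \ u) (by rw [Finset.card_sdiff_of_subset hus]; omega)
    obtain ⟨i, i', hii, rfl⟩ := Finset.card_eq_two.1 hu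
    refine (h.add (two_mul hc (T i) (T i'))).congr fun x => ?_
    rw [← Finset.sum_sdiff hus, Finset.sum_pair hii]
    ring

theorem four_dvd_sum {ι : Type*} {c p q r s : K} (hc : c = p ^ 2 + q ^ 2 + r ^ 2 + s ^ 2)
    (T : ι → V →ₗ[K] K) : ∀ (j : ℕ) (S : Finset ι), S.card = 4 * j →
      IsSumOfSquares K (4 * j) (fun x => c * ∑ i ∈ S, T i x ^ 2) := by
  classical
  intro j
  induction j with
  | zero =>
    intro S hS
    obtain rfl : S = ∅ := by simpa using hS
    simpa using zero
  | succ j ih =>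
    intro S hS
    obtain ⟨u, huS, hu⟩ := Finset.exists_subset_card_eq (show 4 ≤ S.card by omega)
    have h := ih (S \ u) (by rw [Finset.card_sdiff_of_subset huS]; omega)
    obtain ⟨a, u', ha, rfl, hu'⟩ := Finset.card_eq_succ.1 hu
    obtain ⟨b, d, e, hbd, hbe, hde, rfl⟩ := Finset.card_eq_three.1 hu'
    refine (h.add (four_mul hc (T a) (T b) (T d) (T e))).congr fun x => ?_
    rw [← Finset.sum_sdiff huS, Finset.sum_insert ha, Finset.sum_insert (by simp [hbd, hbe]),
      Finset.sum_pair hde]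
    ring

end IsSumOfSquares

/-- A nondegenerate form cannot be both a sum of `r` squares plus an anisotropic ternary form, and
a sum of `r` squares plus a form vanishing on a subspace of codimension two. -/
theorem false_of_anisotropic_of_isotropic [FiniteDimensional K V] (h2 : (2 : K) ≠ 0)
    {Q : V → K} (hQ : ∀ x, (∀ y, Q (x + y) = Q y) → x = 0) {r : ℕ}
    (hr : r + 3 ≤ Module.finrank K V) {f f' g' : V → K}
    (hf : IsSumOfSquares K r f) (hf' : IsSumOfSquares K r f')
    {c₁ c₂ c₃ : K} (X Y Z : V →ₗ[K] K)
    (han : ∀ x y z : K, c₁ * x ^ 2 + c₂ * y ^ 2 + c₃ * z ^ 2 = 0 → x = 0 ∧ y = 0 ∧ z = 0)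
    (hQf : ∀ x, Q x = f x + (c₁ * X x ^ 2 + c₂ * Y x ^ 2 + c₃ * Z x ^ 2))
    (hQf' : ∀ x, Q x = f' x + g' x)
    (G H : V →ₗ[K] K) (hg' : ∀ x, G x = 0 → H x = 0 → g' x = 0) : False := by
  obtain ⟨L, hL⟩ := hf
  obtain ⟨M, hM⟩ := hf'
  obtain ⟨U, hU, hsq, hUZ⟩ := exists_submodule_sq_eq_sq h2 r L M
    (LinearMap.ker X ⊓ LinearMap.ker Y ⊓ LinearMap.ker Z) (by
      rintro x ⟨⟨hX, hY⟩, hZ⟩ hx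
      refine hQ x fun y => ?_
      rw [SetLike.mem_coe, LinearMap.mem_ker] at hX hY hZ
      simp [hQf, hL, hX, hY, hZ, hx])
  -- Here `U` has dimension at least 3, so the conditions `G = H = 0` leave a nonzero `x` in it.
  -- There `f x = f' x` and `g' x = 0`, so the ternary form vanishes; anisotropy puts `x` in the
  -- common kernel of `X`, `Y`, `Z`, which `U` meets only in zero.
  have h3 := finrank_le_finrank_inf_ker_add_one U G
  have h4 := finrank_le_finrank_inf_ker_add_one (U ⊓ LinearMap.ker G) H
  have h5 : 0 < Module.finrank K (U ⊓ LinearMap.ker G ⊓ LinearMap.ker H : Submodule K V) := by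
    omega
  rw [Module.finrank_pos_iff] at h5
  obtain ⟨⟨x, ⟨hxU, hxG⟩, hxH⟩, hx0⟩ := exists_ne
    (0 : (U ⊓ LinearMap.ker G ⊓ LinearMap.ker H : Submodule K V))
  refine hx0 (Subtype.ext (hUZ x hxU ?_))
  have e : f x = f' x := by
    rw [hL, hM]
    exact Finset.sum_congr rfl fun i _ => hsq x hxU i
  obtain ⟨a, b, c⟩ := han (X x) (Y x) (Z x) (by
    have e1 := hQf x
    rw [hQf' x, hg' x hxG hxH, e] at e1
    linear_combination -e1)
  exact ⟨⟨a, b⟩, c⟩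

end QuadraticCancellation

/-! ### Squares and ternary forms over the 2-adic and 5-adic numbers. -/

section PadicForms

theorem PadicInt.exists_sq_eq {p : ℕ} [Fact p.Prime] {a c : ℤ_[p]}
    (h : ‖a ^ 2 - c‖ < ‖2 * a‖ ^ 2) : ∃ z : ℤ_[p], z ^ 2 = c := by
  obtain ⟨z, hz, -⟩ := hensels_lemma (F := (Polynomial.X ^ 2 - Polynomial.C c : Polynomial ℤ_[p]))
    (a := a) (by simpa [← two_mul, one_add_one_eq_two] using h)
  exact ⟨z, by simpa [sub_eq_zero] using hz⟩

theorem Padic.exists_sq_eq_intCast_two {c : ℤ} (hc : c % 8 = 1) : ∃ z : ℚ_[2], z ^ 2 = c := by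
  obtain ⟨z, hz⟩ := PadicInt.exists_sq_eq (p := 2) (a := 1) (c := c) (by
    have h1 : ‖((1 - c : ℤ) : ℤ_[2])‖ ≤ (2 : ℝ) ^ (-(3 : ℕ) : ℤ) := by
      have := (PadicInt.norm_int_le_pow_iff_dvd (p := 2) (k := 1 - c) (n := 3)).2
        (by push_cast; omega)
      exact_mod_cast this
    have h2 : ‖(2 : ℤ_[2])‖ = 2⁻¹ := by exact_mod_cast PadicInt.norm_p (p := 2)
    push_cast at h1
    rw [one_pow, mul_one, h2]
    refine h1.trans_lt ?_
    norm_num)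
  exact ⟨z, by exact_mod_cast congrArg ((↑) : ℤ_[2] → ℚ_[2]) hz⟩

instance : Fact (Nat.Prime 5) := ⟨by norm_num⟩

theorem Padic.exists_sq_eq_intCast_five {c d : ℤ} (hd : ¬ (5 : ℤ) ∣ 2 * d)
    (hc : (5 : ℤ) ∣ d ^ 2 - c) : ∃ z : ℚ_[5], z ^ 2 = c := by
  obtain ⟨z, hz⟩ := PadicInt.exists_sq_eq (p := 5) (a := d) (c := c) (by
    have h1 : ‖((d ^ 2 - c : ℤ) : ℤ_[5])‖ < 1 :=
      (PadicInt.norm_int_lt_one_iff_dvd _).2 (by exact_mod_cast hc)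
    have h2 : ‖((2 * d : ℤ) : ℤ_[5])‖ = 1 := by
      refine le_antisymm (PadicInt.norm_le_one _) (not_lt.1 fun h => hd ?_)
      exact_mod_cast (PadicInt.norm_int_lt_one_iff_dvd _).1 h
    push_cast at h1 h2
    rw [h2]
    simpa using h1)
  exact ⟨z, by exact_mod_cast congrArg ((↑) : ℤ_[5] → ℚ_[5]) hz⟩

theorem Padic.exists_add_sq_eq_intCast_two {c : ℤ} (hc : c % 4 = 1) :
    ∃ x y : ℚ_[2], c = x ^ 2 + y ^ 2 := by
  obtain h | h : c % 8 = 1 ∨ c % 8 = 5 := by omega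
  · obtain ⟨z, hz⟩ := Padic.exists_sq_eq_intCast_two h
    exact ⟨z, 0, by rw [hz]; ring⟩
  · obtain ⟨z, hz⟩ := Padic.exists_sq_eq_intCast_two (c := 5 * c) (by omega)
    push_cast at hz
    exact ⟨z / 5, 2 * z / 5, by linear_combination -hz / 5⟩

/-- Modulo 8 the values 1, 3, 13 = 1 + 3·4 and 7 = 4 + 3 of the form cover all odd classes, and an
odd integer is determined up to 2-adic squares by its class. -/
theorem Padic.exists_sq_add_three_mul_sq_eq_intCast_two {c : ℤ} (hc : c % 2 = 1) :
    ∃ x y : ℚ_[2], x ^ 2 + 3 * y ^ 2 = c := by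
  obtain h | h | h | h : c % 8 = 1 ∨ c % 8 = 3 ∨ c % 8 = 5 ∨ c % 8 = 7 := by omega
  · obtain ⟨z, hz⟩ := Padic.exists_sq_eq_intCast_two h
    exact ⟨z, 0, by rw [hz]; ring⟩
  · obtain ⟨z, hz⟩ := Padic.exists_sq_eq_intCast_two (c := 3 * c) (by omega)
    push_cast at hz
    exact ⟨0, z / 3, by linear_combination hz / 3⟩
  · obtain ⟨z, hz⟩ := Padic.exists_sq_eq_intCast_two (c := 13 * c) (by omega)
    push_cast at hz
    exact ⟨z / 13, 2 * z / 13, by linear_combination hz / 13⟩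
  · obtain ⟨z, hz⟩ := Padic.exists_sq_eq_intCast_two (c := 7 * c) (by omega)
    push_cast at hz
    exact ⟨2 * z / 7, z / 7, by linear_combination hz / 7⟩

/-- Division by a coordinate of largest norm. Making one coordinate equal to 1, not merely a unit,
shortens the finite searches modulo `p ^ e`. -/
theorem Padic.exists_primitive {p : ℕ} [Fact p.Prime] {x y z : ℚ_[p]}
    (h : ¬ (x = 0 ∧ y = 0 ∧ z = 0)) :
    ∃ (s : ℚ_[p]) (a b c : ℤ_[p]), (a : ℚ_[p]) = s * x ∧ (b : ℚ_[p]) = s * y ∧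
      (c : ℚ_[p]) = s * z ∧ (a = 1 ∨ b = 1 ∨ c = 1) := by
  have key : ∀ w : ℚ_[p], w ≠ 0 → ∀ u : ℚ_[p], ‖u‖ ≤ ‖w‖ →
      ∃ a : ℤ_[p], (a : ℚ_[p]) = w⁻¹ * u := by
    intro w hw u hu
    refine ⟨⟨w⁻¹ * u, ?_⟩, rfl⟩
    rw [norm_mul, norm_inv, inv_mul_le_iff₀ (norm_pos_iff.2 hw)]
    simpa using hu
  by_cases hx : ‖y‖ ≤ ‖x‖ ∧ ‖z‖ ≤ ‖x‖
  · have hx0 : x ≠ 0 := by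
      rintro rfl
      exact h (by simpa using hx)
    obtain ⟨b, hb⟩ := key x hx0 y hx.1
    obtain ⟨c, hc⟩ := key x hx0 z hx.2
    exact ⟨x⁻¹, 1, b, c, by simp [hx0], hb, hc, Or.inl rfl⟩
  by_cases hy : ‖x‖ ≤ ‖y‖ ∧ ‖z‖ ≤ ‖y‖
  · have hy0 : y ≠ 0 := by
      rintro rfl
      exact h (by simpa using hy)
    obtain ⟨a, ha⟩ := key y hy0 x hy.1
    obtain ⟨c, hc⟩ := key y hy0 z hy.2
    exact ⟨y⁻¹, a, 1, c, ha, by simp [hy0], hc, Or.inr (Or.inl rfl)⟩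
  have hz : ‖x‖ ≤ ‖z‖ ∧ ‖y‖ ≤ ‖z‖ := by
    by_contra hz
    grind
  have hz0 : z ≠ 0 := by
    rintro rfl
    exact h (by simpa using hz)
  obtain ⟨a, ha⟩ := key z hz0 x hz.1
  obtain ⟨b, hb⟩ := key z hz0 y hz.2
  exact ⟨z⁻¹, a, b, 1, ha, hb, by simp [hz0], Or.inr (Or.inr rfl)⟩

theorem Padic.anisotropic_of_zmod {p : ℕ} [Fact p.Prime] (e : ℕ) (c₁ c₂ c₃ : ℤ)
    (h : ∀ x y z : ZMod (p ^ e), (x = 1 ∨ y = 1 ∨ z = 1) →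
      (c₁ : ZMod (p ^ e)) * x ^ 2 + c₂ * y ^ 2 + c₃ * z ^ 2 ≠ 0) (x y z : ℚ_[p])
    (h0 : (c₁ : ℚ_[p]) * x ^ 2 + c₂ * y ^ 2 + c₃ * z ^ 2 = 0) : x = 0 ∧ y = 0 ∧ z = 0 := by
  by_contra hne
  obtain ⟨s, a, b, c, ha, hb, hc, h1⟩ := Padic.exists_primitive hne
  have h2 : (c₁ : ℤ_[p]) * a ^ 2 + c₂ * b ^ 2 + c₃ * c ^ 2 = 0 := by
    apply Subtype.ext
    push_cast
    rw [ha, hb, hc]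
    linear_combination s ^ 2 * h0
  refine h (PadicInt.toZModPow e a) (PadicInt.toZModPow e b) (PadicInt.toZModPow e c) ?_ ?_
  · rcases h1 with rfl | rfl | rfl <;> simp
  · have := congrArg (PadicInt.toZModPow (p := p) e) h2
    simpa using this

theorem Padic.anisotropic_two {n : ℤ} (hn : n % 4 = 1) (x y z : ℚ_[2])
    (h : 1 * x ^ 2 + 1 * y ^ 2 + (n : ℚ_[2]) * z ^ 2 = 0) : x = 0 ∧ y = 0 ∧ z = 0 := by
  refine Padic.anisotropic_of_zmod 2 1 1 n ?_ x y z (by exact_mod_cast h)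
  have h4 : (n : ZMod (2 ^ 2)) = 1 := by
    have := (ZMod.intCast_eq_intCast_iff_dvd_sub 1 n (2 ^ 2)).2 (by push_cast; omega)
    exact_mod_cast this.symm
  rw [h4]
  push_cast
  decide

/-- After multiplication by 6 the form is `y² + 3z²` modulo 5, which has no nontrivial zero since -3
is not a square. In a primitive zero `y` and `z` would be divisible by 5 and `x` would not, forcing
`25 ∣ l`. -/
theorem Padic.anisotropic_five {l : ℤ} (hl : l % 5 = 0) (hl' : l % 25 ≠ 0) (x y z : ℚ_[5])
    (h : (l : ℚ_[5]) / 2 * x ^ 2 + ((l + 1 : ℤ) : ℚ_[5]) / 6 * y ^ 2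
      + ((l + 4 : ℤ) : ℚ_[5]) / 3 * z ^ 2 = 0) :
    x = 0 ∧ y = 0 ∧ z = 0 := by
  refine Padic.anisotropic_of_zmod 2 (3 * l) (l + 1) (2 * (l + 4)) ?_ x y z
    (by push_cast at h ⊢; linear_combination 6 * h)
  obtain ⟨j, hj, hj'⟩ : ∃ j : ℤ, (l : ZMod (5 ^ 2)) = j ∧ (j = 5 ∨ j = 10 ∨ j = 15 ∨ j = 20) :=
    ⟨l % 25, ((ZMod.intCast_eq_intCast_iff_dvd_sub l (l % 25) (5 ^ 2)).2
      (by push_cast; omega)), by omega⟩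
  push_cast
  rw [hj]
  have key : ∀ j ∈ ({5, 10, 15, 20} : Finset (ZMod 25)), ∀ x y : ZMod 25,
      3 * j * 1 ^ 2 + (j + 1) * x ^ 2 + 2 * (j + 4) * y ^ 2 ≠ 0 ∧
      3 * j * x ^ 2 + (j + 1) * 1 ^ 2 + 2 * (j + 4) * y ^ 2 ≠ 0 ∧
      3 * j * x ^ 2 + (j + 1) * y ^ 2 + 2 * (j + 4) * 1 ^ 2 ≠ 0 := by
    decide +kernel
  have hj'' : ((j : ℤ) : ZMod 25) ∈ ({5, 10, 15, 20} : Finset (ZMod 25)) := by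
    rcases hj' with rfl | rfl | rfl | rfl <;> decide
  rintro x y z (rfl | rfl | rfl)
  · exact (key _ hj'' y z).1
  · exact (key _ hj'' x z).2.1
  · exact (key _ hj'' x y).2.2

end PadicForms

/-! ### The quadratic form of a single 2-cycle or 3-cycle. -/

section CycleForms

namespace LooplessMultigraph

variable {K : Type*}

theorem sum_cycle_mult {c : ℕ} (hc : c = 2 ∨ c = 3) (a : Fin c) :
    ∑ b, (cycle c).mult a b = 2 := by
  rcases hc with rfl | rfl
  · revert a; decide
  · revert a; decide

/-- The all-ones vector has eigenvalue `κ + 1`. Its orthogonal complement has eigenvalue `κ - 3` for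
a 2-cycle and `κ - 2`, twice, for a 3-cycle; the denominators are squared lengths of orthogonal
eigenvectors. -/
theorem exists_diag_cycle [Field K] [CharZero K] {c : ℕ} (hc : c = 2 ∨ c = 3) (κ : K) :
    ∃ δ ε : (Fin c → K) →ₗ[K] K, ∀ g : Fin c → K,
      (κ - 1) * ∑ a, g a ^ 2 + ∑ a, ∑ b, ((cycle c).mult a b : K) * (g a * g b) =
        (κ + 1) / c * (∑ a, g a) ^ 2 + if c = 2 then (κ - 3) / 2 * δ g ^ 2
          else (κ - 2) / 2 * δ g ^ 2 + (κ - 2) / 6 * ε g ^ 2 := by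
  rcases hc with rfl | rfl
  · let X : Fin 2 → (Fin 2 → K) →ₗ[K] K := fun a => LinearMap.proj a
    refine ⟨X 0 - X 1, 0, fun g => ?_⟩
    simp [Fin.sum_univ_two, cycle, X]
    ring
  · let X : Fin 3 → (Fin 3 → K) →ₗ[K] K := fun a => LinearMap.proj a
    refine ⟨X 0 - X 1, X 0 + X 1 - (2 : K) • X 2, fun g => ?_⟩
    simp [Fin.sum_univ_three, cycle, X]
    ring

theorem sum_eq_of_cycle_equations [Field K] {c : ℕ} (hc : c = 2 ∨ c = 3) {κ S : K}
    {g : Fin c → K}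
    (h : ∀ a, (κ - 1) * g a + ∑ b, ((cycle c).mult a b : K) * g b = -S) :
    (κ + 1) * ∑ a, g a = -c * S := by
  rcases hc with rfl | rfl
  · have h0 := h 0
    have h1 := h 1
    simp [Fin.sum_univ_two, cycle] at h0 h1 ⊢
    linear_combination h0 + h1
  · have h0 := h 0
    have h1 := h 1
    have h2 := h 2
    simp [Fin.sum_univ_three, cycle] at h0 h1 h2 ⊢
    linear_combination h0 + h1 + h2

theorem eq_zero_of_cycle_equations [Field K] {c : ℕ} (hc : c = 2 ∨ c = 3) {κ : K}
    (h1 : κ + 1 ≠ 0) (h2 : κ - 2 ≠ 0) (h3 : κ - 3 ≠ 0) {g : Fin c → K}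
    (h : ∀ a, (κ - 1) * g a + ∑ b, ((cycle c).mult a b : K) * g b = 0) : g = 0 := by
  have hs : ∑ a, g a = 0 := by
    have := sum_eq_of_cycle_equations (S := 0) hc (fun a => (h a).trans neg_zero.symm)
    rw [mul_zero] at this
    exact (mul_eq_zero.1 this).resolve_left h1
  rcases hc with rfl | rfl
  · have key : ∀ a, (κ - 3) * g a = 0 := by
      intro a
      have ha := h a
      fin_cases a <;> simp [Fin.sum_univ_two, cycle, -mul_eq_zero] at ha hs ⊢ <;>
        linear_combination ha - 2 * hs
    funext a
    exact (mul_eq_zero.1 (key a)).resolve_left h3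
  · have key : ∀ a, (κ - 2) * g a = 0 := by
      intro a
      have ha := h a
      fin_cases a <;> simp [Fin.sum_univ_three, cycle, -mul_eq_zero] at ha hs ⊢ <;>
        linear_combination ha - hs
    funext a
    exact (mul_eq_zero.1 (key a)).resolve_left h2

theorem sum_disjointCycles_mult [Semiring K] {t : ℕ} (c : Fin t → ℕ) (i : Fin t) (a : Fin (c i))
    (g : (Σ i, Fin (c i)) → K) :
    ∑ w, ((disjointCycles c).mult ⟨i, a⟩ w : K) * g w =
      ∑ b, ((cycle (c i)).mult a b : K) * g ⟨i, b⟩ := by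
  rw [Fintype.sum_sigma, Finset.sum_eq_single i]
  · simp [disjointCycles]
  · intro j _ hj
    simp [disjointCycles, Ne.symm hj]
  · simp

end LooplessMultigraph

end CycleForms

/-! ### The form of a covering and its two diagonalizations. -/

section Coverings

theorem pairCount_cons {V : Type*} [DecidableEq V] (b : Finset V) (B : Multiset (Finset V))
    (x y : V) :
    pairCount (b ::ₘ B) x y = pairCount B x y + if x ∈ b ∧ y ∈ b then 1 else 0 := by
  simp [pairCount, Multiset.countP_cons]

theorem sum_pairCount {V : Type*} [Fintype V] [DecidableEq V] {k : ℕ} (B : Multiset (Finset V))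
    (hB : ∀ b ∈ B, b.card = k) (x : V) : ∑ y, pairCount B x y = k * pairCount B x x := by
  induction B using Multiset.induction_on with
  | empty => simp [pairCount]
  | cons b B ih =>
    have h := hB b (Multiset.mem_cons_self b B)
    simp only [pairCount_cons, Finset.sum_add_distrib, mul_add,
      ih fun b' hb' => hB b' (Multiset.mem_cons_of_mem hb')]
    by_cases hx : x ∈ b <;> simp [hx, h]

theorem sum_map_sq_sum {V K : Type*} [Fintype V] [DecidableEq V] [CommRing K]
    (B : Multiset (Finset V)) (x : V → K) :
    (B.map fun b => (∑ p ∈ b, x p) ^ 2).sum = ∑ p, ∑ q, x p * ((pairCount B p q : K) * x q) := by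
  induction B using Multiset.induction_on with
  | empty => simp [pairCount]
  | cons b B ih =>
    simp only [Multiset.map_cons, Multiset.sum_cons, ih, pairCount_cons, Nat.cast_add, add_mul,
      mul_add, Finset.sum_add_distrib]
    rw [add_comm, add_right_inj, sq, Finset.sum_mul_sum, ← Finset.sum_filter_add_sum_filter_not
      Finset.univ (· ∈ b)]
    simp only [Finset.filter_mem_eq_inter, Finset.univ_inter]
    rw [Finset.sum_eq_zero (s := Finset.univ.filter (· ∉ b)), add_zero]
    · refine Finset.sum_congr rfl fun p hp => ?_
      simp [hp, Finset.sum_ite_mem]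
    · intro p hp
      simp [(Finset.mem_filter.1 hp).2]

/-- Polarization: invariance under translation by `x` makes `x` orthogonal to everything, and
testing on basis vectors suffices. -/
theorem eq_zero_of_form_invariant {ι K : Type*} [Fintype ι] [DecidableEq ι] [Field K]
    (h2 : (2 : K) ≠ 0) {M : Matrix ι ι K} (hM : M.IsSymm) (hinj : ∀ y, M.mulVec y = 0 → y = 0)
    {n : K} (hn : n ≠ 0) (x : (ι → K) × K)
    (hx : ∀ y : (ι → K) × K, (x + y).1 ⬝ᵥ M.mulVec (x + y).1 + n * (x + y).2 ^ 2 =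
      y.1 ⬝ᵥ M.mulVec y.1 + n * y.2 ^ 2) : x = 0 := by
  have h0 := hx 0
  have key : ∀ y : (ι → K) × K, y.1 ⬝ᵥ M.mulVec x.1 + n * (x.2 * y.2) = 0 := by
    intro y
    have hc : x.1 ⬝ᵥ M.mulVec y.1 = y.1 ⬝ᵥ M.mulVec x.1 := by
      rw [Matrix.dotProduct_mulVec, ← Matrix.mulVec_transpose, hM.eq, dotProduct_comm]
    have := hx y
    simp only [Prod.fst_add, Prod.snd_add, Matrix.mulVec_add, add_dotProduct, dotProduct_add,
      hc] at this
    simp at h0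
    refine (mul_eq_zero.1 (?_ : (2 : K) * _ = 0)).resolve_left h2
    linear_combination this - h0
  have h1 : x.2 = 0 := by simpa [hn] using key (0, 1)
  refine Prod.ext (hinj _ (funext fun i => ?_)) h1
  simpa using key (Pi.single i 1, 0)

namespace PairCovering

variable {V : Type*} [Fintype V] [DecidableEq V] {k v t : ℕ} {c : Fin t → ℕ}

/-- If `r` blocks contain `x`, counting their points gives `k r = r + (v - 1) + 2`, because the
excess is 2-regular. Hence `(k - 1) r = v + 1 = k (k - 1)`. -/
theorem pairCount_self (C : PairCovering V v k 1) (hc : ∀ i, c i = 2 ∨ c i = 3)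
    (e : V ≃ Σ i, Fin (c i))
    (he : ∀ x y, C.excess.mult x y = (LooplessMultigraph.disjointCycles c).mult (e x) (e y))
    (hk : 4 ≤ k) (hv : (v : ℤ) = k * (k - 1) - 1) (x : V) : pairCount C.blocks x x = k := by
  have h1 := sum_pairCount C.blocks C.card_block x
  have h2 : ∑ y, C.excess.mult x y = 2 := by
    simp only [he]
    rw [e.sum_comp fun w => (LooplessMultigraph.disjointCycles c).mult (e x) w]
    have := LooplessMultigraph.sum_disjointCycles_mult (K := ℕ) c (e x).1 (e x).2 fun _ => 1
    simpa [LooplessMultigraph.sum_cycle_mult (hc _)] using this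
  have h3 : ∀ y, pairCount C.blocks x y + (if x = y then 1 else 0) =
      C.excess.mult x y + 1 + if x = y then pairCount C.blocks x x else 0 := by
    intro y
    by_cases h : x = y
    · subst h
      simp [excess]
      ring
    · have := C.covers x y h
      simp [excess, h]
      omega
  have h4 := Finset.sum_congr (rfl : (Finset.univ : Finset V) = Finset.univ) fun y _ => h3 y
  simp only [Finset.sum_add_distrib, h1, h2, Finset.sum_ite_eq, Finset.mem_univ, if_true,
    Finset.sum_const, Finset.card_univ, C.card_points, smul_eq_mul, mul_one] at h4
  zify at h4 ⊢
  have h5 : ((k : ℤ) - 1) * (pairCount C.blocks x x - k) = 0 := by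
    linear_combination h4 + hv
  rcases mul_eq_zero.1 h5 with h | h <;> omega

theorem cast_pairCount (K : Type*) [Ring K] (C : PairCovering V v k 1)
    (hc : ∀ i, c i = 2 ∨ c i = 3) (e : V ≃ Σ i, Fin (c i))
    (he : ∀ x y, C.excess.mult x y = (LooplessMultigraph.disjointCycles c).mult (e x) (e y))
    (hk : 4 ≤ k) (hv : (v : ℤ) = k * (k - 1) - 1) (p q : Σ i, Fin (c i)) :
    (pairCount C.blocks (e.symm p) (e.symm q) : K) =
      1 + (if p = q then (k : K) - 1 else 0)
        + (LooplessMultigraph.disjointCycles c).mult p q := by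
  have h := he (e.symm p) (e.symm q)
  rw [e.apply_symm_apply, e.apply_symm_apply] at h
  rw [← h]
  by_cases hpq : p = q
  · subst hpq
    simp [excess, C.pairCount_self hc e he hk hv]
  · have h1 := C.covers (e.symm p) (e.symm q) (by simpa using hpq)
    simp [excess, hpq, Nat.cast_sub h1]

theorem card_filter_add (C : PairCovering V v k 1) (hc : ∀ i, c i = 2 ∨ c i = 3)
    (e : V ≃ Σ i, Fin (c i)) :
    2 * (Finset.univ.filter fun i => c i = 2).card + 3 * (Finset.univ.filter fun i => c i ≠ 2).card
      = v := by
  rw [← C.card_points, Fintype.card_congr e, Fintype.card_sigma, Finset.card_filter,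
    Finset.card_filter, Finset.mul_sum, Finset.mul_sum, ← Finset.sum_add_distrib]
  refine Finset.sum_congr rfl fun i _ => ?_
  rcases hc i with h | h <;> simp [h]

/-- Two diagonalizations, over any field of characteristic zero, of the quadratic form
`y ↦ ∑ b, (∑ p ∈ b, y p) ^ 2` extended by one more variable. -/
theorem exists_diagonalizations (K : Type*) [Field K] [CharZero K] (C : PairCovering V v k 1)
    (hsym : C.IsSymmetric) (hc : ∀ i, c i = 2 ∨ c i = 3) (e : V ≃ Σ i, Fin (c i))
    (he : ∀ x y, C.excess.mult x y = (LooplessMultigraph.disjointCycles c).mult (e x) (e y))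
    (hk : 4 ≤ k) (hv : (v : ℤ) = k * (k - 1) - 1) :
    ∃ (Q f : ((Σ i, Fin (c i)) → K) × K → K) (ω ζ : ((Σ i, Fin (c i)) → K) × K →ₗ[K] K)
      (τ δ ε : Fin t → ((Σ i, Fin (c i)) → K) × K →ₗ[K] K),
      (∀ x, (∀ y, Q (x + y) = Q y) → x = 0) ∧ IsSumOfSquares K v f ∧
      (∀ x, Q x = f x + (k + 1) * ζ x ^ 2) ∧
      ∀ x, Q x = ω x ^ 2 + (k + 1) / 2 * ∑ i with c i = 2, τ i x ^ 2
        + (k - 3) / 2 * ∑ i with c i = 2, δ i x ^ 2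
        + (k + 1) / 3 * ∑ i with c i ≠ 2, τ i x ^ 2
        + (k - 2) / 2 * ∑ i with c i ≠ 2, δ i x ^ 2
        + (k - 2) / 6 * ∑ i with c i ≠ 2, ε i x ^ 2 := by
  have hk0 : (k : K) ≠ 0 := by exact_mod_cast (by omega : k ≠ 0)
  have hk1 : (k : K) + 1 ≠ 0 := by exact_mod_cast (by omega : k + 1 ≠ 0)
  have hk2 : (k : K) - 2 ≠ 0 := by
    rw [sub_ne_zero]; exact_mod_cast (by omega : k ≠ 2)
  have hk3 : (k : K) - 3 ≠ 0 := by
    rw [sub_ne_zero]; exact_mod_cast (by omega : k ≠ 3)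
  have hvK : (v : K) = k * (k - 1) - 1 := by exact_mod_cast congrArg (Int.cast : ℤ → K) hv
  have hcv : ∑ i, (c i : K) = v := by
    have := C.card_points
    rw [Fintype.card_congr e, Fintype.card_sigma] at this
    rw [← this]
    simp
  let M : Matrix (Σ i, Fin (c i)) (Σ i, Fin (c i)) K := fun p q => pairCount C.blocks (e.symm p) (e.symm q)
  have hM : ∀ p q, M p q = 1 + (if p = q then (k : K) - 1 else 0)
      + (LooplessMultigraph.disjointCycles c).mult p q :=
    C.cast_pairCount K hc e he hk hv
  have hMv : ∀ (y : (Σ i, Fin (c i)) → K) (i : Fin t) (a : Fin (c i)), M.mulVec y ⟨i, a⟩ =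
      ∑ w, y w + ((k - 1) * y ⟨i, a⟩
        + ∑ b, ((LooplessMultigraph.cycle (c i)).mult a b : K) * y ⟨i, b⟩) := by
    intro y i a
    rw [← LooplessMultigraph.sum_disjointCycles_mult c i a y, ← add_assoc]
    simp only [Matrix.mulVec, dotProduct, hM, add_mul, Finset.sum_add_distrib, one_mul, ite_mul,
      zero_mul, Finset.sum_ite_eq, Finset.mem_univ, if_true]
  have hinj : ∀ y, M.mulVec y = 0 → y = 0 := by
    intro y hy
    have h1 : ∀ i (a : Fin (c i)), (k - 1) * y ⟨i, a⟩
        + ∑ b, ((LooplessMultigraph.cycle (c i)).mult a b : K) * y ⟨i, b⟩ = -∑ w, y w := by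
      intro i a
      have := hMv y i a
      rw [hy, Pi.zero_apply] at this
      linear_combination -this
    have h2 : (k + 1 : K) * ∑ w, y w = -v * ∑ w, y w := by
      nth_rw 1 [Fintype.sum_sigma]
      rw [Finset.mul_sum, ← hcv, ← Finset.sum_neg_distrib, Finset.sum_mul]
      exact Finset.sum_congr rfl fun i _ =>
        LooplessMultigraph.sum_eq_of_cycle_equations (hc i) (h1 i)
    have h3 : ∑ w, y w = 0 := by
      -- The factor is `k + 1 + v = k ^ 2`.
      have : (k : K) ^ 2 * ∑ w, y w = 0 := by
        rw [hvK] at h2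
        linear_combination h2
      simpa [hk0] using this
    funext ⟨i, a⟩
    rw [h3, neg_zero] at h1
    exact congrFun (LooplessMultigraph.eq_zero_of_cycle_equations (g := fun a => y ⟨i, a⟩) (hc i)
      hk1 hk2 hk3 (h1 i)) a
  have hMs : M.IsSymm := Matrix.IsSymm.ext fun p q => by
    simp only [M, pairCount, and_comm]
  choose δ ε hδε using fun i => LooplessMultigraph.exists_diag_cycle (hc i) (k : K)
  let π : ∀ i, ((Σ i, Fin (c i)) → K) × K →ₗ[K] (Fin (c i) → K) := fun i =>
    LinearMap.pi (fun a => LinearMap.proj ⟨i, a⟩) ∘ₗ LinearMap.fst K _ _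
  let ζ : ((Σ i, Fin (c i)) → K) × K →ₗ[K] K := LinearMap.snd K _ _
  let σ : ((Σ i, Fin (c i)) → K) × K →ₗ[K] K := (∑ w, LinearMap.proj w) ∘ₗ LinearMap.fst K _ _
  let s : Fin t → ((Σ i, Fin (c i)) → K) × K →ₗ[K] K := fun i => (∑ a, LinearMap.proj a) ∘ₗ π i
  let T : Finset V → ((Σ i, Fin (c i)) → K) × K →ₗ[K] K := fun b =>
    (∑ p ∈ b, LinearMap.proj (e p)) ∘ₗ LinearMap.fst K _ _
  have hs : ∀ i x, s i x = ∑ a, π i x a := fun i x => by simp [s]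
  have hσ : ∀ x, σ x = ∑ w, x.1 w := fun x => by simp [σ]
  have hσs : ∀ x, σ x = ∑ i, s i x := fun x => by
    rw [hσ, Fintype.sum_sigma]
    simp [hs, π]
  have hform : ∀ x : ((Σ i, Fin (c i)) → K) × K, x.1 ⬝ᵥ M.mulVec x.1 = σ x ^ 2
      + ∑ i, ((k + 1) / c i * s i x ^ 2 + if c i = 2 then (k - 3) / 2 * δ i (π i x) ^ 2
          else (k - 2) / 2 * δ i (π i x) ^ 2 + (k - 2) / 6 * ε i (π i x) ^ 2) := by
    intro x
    simp only [hs, ← hδε]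
    rw [hσ, sq]
    nth_rw 1 [Finset.sum_mul]
    rw [dotProduct]
    simp only [Fintype.sum_sigma, hMv, mul_add, Finset.sum_add_distrib]
    congr 2
    · refine Finset.sum_congr rfl fun i _ => ?_
      rw [Finset.mul_sum]
      exact Finset.sum_congr rfl fun a _ => by simp [π]; ring
    · refine Finset.sum_congr rfl fun i _ => Finset.sum_congr rfl fun a _ => ?_
      rw [Finset.mul_sum]
      exact Finset.sum_congr rfl fun b _ => by simp [π]; ring
  -- The shifts by multiples of `ζ` make the cross terms cancel, since `σ = ∑ s i`. The remaining
  -- coefficient of `ζ²` is `(k + 1) / k² * (v + k + 1) = k + 1`.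
  refine ⟨fun x => x.1 ⬝ᵥ M.mulVec x.1 + (k + 1) * x.2 ^ 2, fun x => x.1 ⬝ᵥ M.mulVec x.1,
    σ - ((k + 1 : K) / k) • ζ, ζ, fun i => s i + ((c i : K) / k) • ζ, fun i => δ i ∘ₗ π i,
    fun i => ε i ∘ₗ π i, eq_zero_of_form_invariant two_ne_zero hMs hinj hk1, ?_, fun x => rfl, ?_⟩
  · rw [← hsym]
    refine (IsSumOfSquares.multiset_sum C.blocks T).congr fun x => ?_
    have := sum_map_sq_sum C.blocks fun p => x.1 (e p)
    simp only [T, LinearMap.comp_apply, LinearMap.sum_apply, LinearMap.proj_apply,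
      LinearMap.fst_apply, this]
    rw [← e.symm.sum_comp]
    refine Finset.sum_congr rfl fun p _ => ?_
    rw [← e.symm.sum_comp, ← Finset.mul_sum]
    simp [Matrix.mulVec, dotProduct, M]
  · intro x
    have hsplit : ∀ i, (k + 1 : K) / c i * s i x ^ 2 + (if c i = 2 then (k - 3) / 2 * δ i (π i x) ^ 2
          else (k - 2) / 2 * δ i (π i x) ^ 2 + (k - 2) / 6 * ε i (π i x) ^ 2) =
        (if c i = 2 then (k + 1) / 2 * (s i x + c i / k * x.2) ^ 2 + (k - 3) / 2 * δ i (π i x) ^ 2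
          else (k + 1) / 3 * (s i x + c i / k * x.2) ^ 2 + (k - 2) / 2 * δ i (π i x) ^ 2
            + (k - 2) / 6 * ε i (π i x) ^ 2)
        - 2 * (k + 1) / k * x.2 * s i x - (k + 1) / k ^ 2 * x.2 ^ 2 * c i := by
      intro i
      rcases hc i with h | h
      · simp only [h, if_true]
        field_simp
        push_cast
        ring
      · have h' : ¬ (3 : ℕ) = 2 := by norm_num
        simp only [h, h', if_false]
        field_simp
        push_cast
        ring
    simp only [hform, hsplit, Finset.sum_sub_distrib, ← Finset.mul_sum, ← hσs, hcv, hvK,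
      Finset.sum_ite, Finset.sum_add_distrib]
    simp only [LinearMap.sub_apply, LinearMap.add_apply, LinearMap.smul_apply, smul_eq_mul, ζ,
      LinearMap.snd_apply, LinearMap.comp_apply]
    generalize (∑ i with c i = 2, (s i x + c i / k * x.2) ^ 2) = a₁
    generalize (∑ i with c i ≠ 2, (s i x + c i / k * x.2) ^ 2) = a₂
    field_simp
    ring

end PairCovering

end Coverings

/-! ### The local obstructions at 5 and 2, and their conflict. -/

section Nonexistence

theorem exists_four_sq_div (K : Type*) [Field K] [CharZero K] (N : ℕ) {d : ℕ} (hd : d ≠ 0) :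
    ∃ p q r s : K, (N : K) / d = p ^ 2 + q ^ 2 + r ^ 2 + s ^ 2 := by
  obtain ⟨p, q, r, s, h⟩ := Nat.sum_four_squares (N * d)
  have hd' : (d : K) ≠ 0 := by exact_mod_cast hd
  have h' : (p : K) ^ 2 + q ^ 2 + r ^ 2 + s ^ 2 = N * d := by exact_mod_cast h
  refine ⟨p / d, q / d, r / d, s / d, ?_⟩
  field_simp
  linear_combination -h'

theorem exists_add_sq_of_sq_eq_neg_one {K : Type*} [Field K] [CharZero K] {i : K}
    (hi : i ^ 2 = -1) (c : K) : ∃ p q : K, c = p ^ 2 + q ^ 2 :=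
  ⟨(c + 1) / 2, i * (c - 1) / 2, by linear_combination -((c - 1) ^ 2 / 4) * hi⟩

namespace PairCovering

variable {V : Type*} [Fintype V] [DecidableEq V] {k v t : ℕ} {c : Fin t → ℕ}

theorem finrank_form_space (K : Type*) [Field K] (C : PairCovering V v k 1)
    (e : V ≃ Σ i, Fin (c i)) :
    Module.finrank K (((Σ i, Fin (c i)) → K) × K) = v + 1 := by
  rw [Module.finrank_prod, Module.finrank_self, Module.finrank_fintype_fun_eq_card,
    ← Fintype.card_congr e, C.card_points]

/-- The 5-adic obstruction. -/
theorem even_card_two_cycles (C : PairCovering V v k 1) (hsym : C.IsSymmetric)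
    (hc : ∀ i, c i = 2 ∨ c i = 3) (e : V ≃ Σ i, Fin (c i))
    (he : ∀ x y, C.excess.mult x y = (LooplessMultigraph.disjointCycles c).mult (e x) (e y))
    (hk : 4 ≤ k) (hv : (v : ℤ) = k * (k - 1) - 1) (hk5 : k % 5 = 3) (hk25 : k % 25 ≠ 3)
    (hodd : v % 2 = 1) : (Finset.univ.filter fun i => c i = 2).card % 2 = 0 := by
  by_contra hA
  have hcard := C.card_filter_add hc e
  obtain ⟨Q, f, ω, ζ, τ, δ, ε, hnd, hf, hQ, hQ'⟩ :=
    C.exists_diagonalizations ℚ_[5] hsym hc e he hk hv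
  have hdim := C.finrank_form_space ℚ_[5] e
  set A := Finset.univ.filter fun i => c i = 2
  set B := Finset.univ.filter fun i => c i ≠ 2
  obtain ⟨j, hj⟩ : ∃ j, A.card = 2 * j + 1 := ⟨A.card / 2, by omega⟩
  obtain ⟨l, hl⟩ : ∃ l, B.card = 2 * l + 1 := ⟨B.card / 2, by omega⟩
  obtain ⟨a, ha⟩ : A.Nonempty := Finset.card_pos.1 (by omega)
  obtain ⟨b, hb⟩ : B.Nonempty := Finset.card_pos.1 (by omega)
  have hA' : (A.erase a).card = 2 * j := by rw [Finset.card_erase_of_mem ha]; omega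
  have hB' : (B.erase b).card = 2 * l := by rw [Finset.card_erase_of_mem hb]; omega
  -- Since -1 is a square, every 5-adic number is a sum of two squares. Also `k + 1` and `k - 2` are
  -- squares, being 4 and 1 modulo 5.
  obtain ⟨i, hi⟩ := Padic.exists_sq_eq_intCast_five (c := -1) (d := 2) (by omega) (by norm_num)
  obtain ⟨p, hp⟩ := Padic.exists_sq_eq_intCast_five (c := k + 1) (d := 2) (by omega) (by omega)
  obtain ⟨q, hq⟩ := Padic.exists_sq_eq_intCast_five (c := k - 2) (d := 1) (by omega) (by omega)
  push_cast at hi hp hq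
  have heven : ∀ (γ : ℚ_[5]) (T : Fin t → ((Σ i, Fin (c i)) → ℚ_[5]) × ℚ_[5] →ₗ[ℚ_[5]] ℚ_[5])
      (n : ℕ) (s : Finset (Fin t)), s.card = 2 * n →
      IsSumOfSquares ℚ_[5] (2 * n) (fun x => γ * ∑ i ∈ s, T i x ^ 2) := by
    intro γ T n s hs
    obtain ⟨p, q, h⟩ := exists_add_sq_of_sq_eq_neg_one hi γ
    exact IsSumOfSquares.even_sum h T n s hs
  obtain ⟨r, rfl⟩ : ∃ r, v = r + 1 + 1 := ⟨v - 2, by omega⟩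
  obtain ⟨f₁, M₁, hf₁, hff₁⟩ := hf.exists_of_succ
  obtain ⟨f₂, M₂, hf₂, hff₂⟩ := hf₁.exists_of_succ
  -- Both cycle counts are odd, so one cycle of each length is left over. Of its five terms, `(k +
  -- 1) / 2` and `(k - 2) / 2` pair into two squares (the final 2); the other three form the
  -- anisotropic ternary form.
  have hr : r = 1 + 2 * j + 2 * j + 2 * l + 2 * l + 2 * l + 2 := by omega
  have hg := ((((((IsSumOfSquares.sq ω).add (heven ((k + 1) / 2) τ j _ hA')).add
    (heven ((k - 3) / 2) δ j _ hA')).add (heven ((k + 1) / 3) τ l _ hB')).add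
    (heven ((k - 2) / 2) δ l _ hB')).add (heven ((k - 2) / 6) ε l _ hB')).add
    (IsSumOfSquares.two_mul (show (2 : ℚ_[5]) = 1 ^ 2 + 1 ^ 2 by norm_num) ((p / 2) • τ a)
      ((q / 2) • δ b))
  rw [← hr] at hg
  refine false_of_anisotropic_of_isotropic two_ne_zero hnd (by omega) hg hf₂ (δ a) (ε b) (τ b)
    (c₁ := (k - 3) / 2) (c₂ := (k - 2) / 6) (c₃ := (k + 1) / 3) (fun x y z h => ?_) (fun x => ?_)
    (g' := fun x => M₂ x ^ 2 + M₁ x ^ 2 + (k + 1) * ζ x ^ 2) (fun x => ?_)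
    (M₁ - i • M₂) ζ (fun x h h' => ?_)
  · exact Padic.anisotropic_five (l := k - 3) (by omega) (by omega) x y z
      (by push_cast; linear_combination h)
  · rw [hQ', ← Finset.add_sum_erase A _ ha, ← Finset.add_sum_erase A _ ha,
      ← Finset.add_sum_erase B _ hb, ← Finset.add_sum_erase B _ hb, ← Finset.add_sum_erase B _ hb]
    simp only [LinearMap.smul_apply, smul_eq_mul]
    linear_combination (-(τ a x) ^ 2 / 2) * hp - ((δ b x) ^ 2 / 2) * hq
  · rw [hQ, hff₁, hff₂]
    ring
  · rw [LinearMap.sub_apply, LinearMap.smul_apply, smul_eq_mul, sub_eq_zero] at h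
    rw [h, h']
    linear_combination (M₂ x) ^ 2 * hi

/-- The 2-adic obstruction. -/
theorem odd_card_two_cycles (C : PairCovering V v k 1) (hsym : C.IsSymmetric)
    (hc : ∀ i, c i = 2 ∨ c i = 3) (e : V ≃ Σ i, Fin (c i))
    (he : ∀ x y, C.excess.mult x y = (LooplessMultigraph.disjointCycles c).mult (e x) (e y))
    (hk : 4 ≤ k) (hv : (v : ℤ) = k * (k - 1) - 1) (hk4 : k % 4 = 0) (hv4 : v % 4 = 3) :
    (Finset.univ.filter fun i => c i = 2).card % 2 = 1 := by
  by_contra hA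
  have hcard := C.card_filter_add hc e
  obtain ⟨Q, f, ω, ζ, τ, δ, ε, hnd, hf, hQ, hQ'⟩ :=
    C.exists_diagonalizations ℚ_[2] hsym hc e he hk hv
  have hdim := C.finrank_form_space ℚ_[2] e
  set A := Finset.univ.filter fun i => c i = 2
  set B := Finset.univ.filter fun i => c i ≠ 2
  obtain ⟨j, hj⟩ : ∃ j, A.card = 2 * j := ⟨A.card / 2, by omega⟩
  -- With an even number of 2-cycles, `2 * A.card + 3 * B.card = v ≡ 3` modulo 4 forces `B.card ≡
  -- 1`.
  obtain ⟨l, hl⟩ : ∃ l, B.card = 4 * l + 1 := ⟨B.card / 4, by omega⟩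
  obtain ⟨b, hb⟩ : B.Nonempty := Finset.card_pos.1 (by omega)
  have hB' : (B.erase b).card = 4 * l := by rw [Finset.card_erase_of_mem hb]; omega
  have heven : ∀ n : ℤ, n % 4 = 1 →
      ∀ (T : Fin t → ((Σ i, Fin (c i)) → ℚ_[2]) × ℚ_[2] →ₗ[ℚ_[2]] ℚ_[2]),
      IsSumOfSquares ℚ_[2] (2 * j) (fun x => (n : ℚ_[2]) / 2 * ∑ i ∈ A, T i x ^ 2) := by
    intro n hn T
    obtain ⟨p, q, h⟩ := Padic.exists_add_sq_eq_intCast_two hn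
    exact IsSumOfSquares.even_sum (p := (p + q) / 2) (q := (p - q) / 2) (by rw [h]; ring) T j A hj
  have hfour : ∀ (N d : ℕ), d ≠ 0 →
      ∀ (T : Fin t → ((Σ i, Fin (c i)) → ℚ_[2]) × ℚ_[2] →ₗ[ℚ_[2]] ℚ_[2]),
      IsSumOfSquares ℚ_[2] (4 * l) (fun x => (N : ℚ_[2]) / d * ∑ i ∈ B.erase b, T i x ^ 2) := by
    intro N d hd T
    obtain ⟨p, q, r, s, h⟩ := exists_four_sq_div ℚ_[2] N hd
    exact IsSumOfSquares.four_dvd_sum h T l _ hB'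
  obtain ⟨m, hm⟩ : ∃ m : ℕ, k = 2 * m + 2 := ⟨(k - 2) / 2, by omega⟩
  have hmK : (k : ℚ_[2]) = 2 * m + 2 := by exact_mod_cast congrArg (Nat.cast : ℕ → ℚ_[2]) hm
  have hm0 : (m : ℚ_[2]) ≠ 0 := by exact_mod_cast (by omega : m ≠ 0)
  -- The leftover 3-cycle contributes `m δ² + (m / 3) ε² + ((k + 1) / 3) τ²`. Putting `δ = X τ / (3
  -- m)` and `ε = Y τ / m` makes it vanish exactly when `X² + 3 Y² = -3 (k + 1) m`.
  obtain ⟨X, Y, hXY⟩ := Padic.exists_sq_add_three_mul_sq_eq_intCast_two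
    (c := -3 * ((k + 1) * m)) (by
      have h1 : ((k : ℤ) + 1) % 2 = 1 := by omega
      have h2 : (m : ℤ) % 2 = 1 := by omega
      have h3 : (((k : ℤ) + 1) * m) % 2 = 1 := by rw [Int.mul_emod, h1, h2]; rfl
      omega)
  push_cast at hXY
  obtain ⟨r, rfl⟩ : ∃ r, v = r + 1 + 1 := ⟨v - 2, by omega⟩
  obtain ⟨f₁, M₁, hf₁, hff₁⟩ := hf.exists_of_succ
  obtain ⟨f₂, M₂, hf₂, hff₂⟩ := hf₁.exists_of_succ
  have hr : r = 1 + 2 * j + 2 * j + 4 * l + 4 * l + 4 * l := by omega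
  have hg := (((((IsSumOfSquares.sq ω).add (heven (k + 1) (by omega) τ)).add
    (heven (k - 3) (by omega) δ)).add (hfour (k + 1) 3 (by norm_num) τ)).add
    (hfour (2 * m) 2 (by norm_num) δ)).add (hfour (2 * m) 6 (by norm_num) ε)
  rw [← hr] at hg
  refine false_of_anisotropic_of_isotropic two_ne_zero hnd (by omega) hf₂ hg M₂ M₁ ζ
    (c₁ := 1) (c₂ := 1) (c₃ := k + 1) (fun x y z h => ?_) (fun x => ?_)
    (g' := fun x => (k - 2) / 2 * δ b x ^ 2 + (k - 2) / 6 * ε b x ^ 2 + (k + 1) / 3 * τ b x ^ 2)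
    (fun x => ?_) (δ b - (X / (3 * m)) • τ b) (ε b - (Y / m) • τ b) (fun x h h' => ?_)
  · exact Padic.anisotropic_two (n := k + 1) (by omega) x y z (by push_cast; exact h)
  · rw [hQ, hff₁, hff₂]
    ring
  · rw [hQ', ← Finset.add_sum_erase B _ hb, ← Finset.add_sum_erase B _ hb,
      ← Finset.add_sum_erase B _ hb]
    push_cast
    rw [show (2 : ℚ_[2]) * m = k - 2 by rw [hmK]; ring]
    ring
  · rw [LinearMap.sub_apply, LinearMap.smul_apply, smul_eq_mul, sub_eq_zero] at h h'
    rw [h, h']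
    have e1 : (k : ℚ_[2]) - 2 = 2 * m := by rw [hmK]; ring
    rw [e1]
    field_simp
    linear_combination 6 * τ b x ^ 2 * hXY

end PairCovering

end Nonexistence

theorem mainTheorem10 (k v : ℕ)
    (hk : k ≡ 8 [MOD 100] ∨ k ≡ 48 [MOD 100] ∨ k ≡ 68 [MOD 100] ∨ k ≡ 88 [MOD 100])
    (hv : (v : ℤ) = (k : ℤ) * ((k : ℤ) - 1) - 1)
    (V : Type*) [Fintype V] [DecidableEq V] :
    ¬ ∃ C : PairCovering V v k 1, C.IsSymmetric ∧ C.excess.ConsistsOfTwoAndThreeCycles := by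
  rintro ⟨C, hsym, t, c, ⟨-, e, he⟩, hc⟩
  simp only [Nat.ModEq] at hk
  have hv4 : v % 4 = 3 := by
    obtain ⟨j, hj⟩ : ∃ j : ℤ, (k : ℤ) = 4 * j := ⟨k / 4, by omega⟩
    have h : (v : ℤ) = 4 * (j * (k - 1)) - 1 := by
      rw [hv, hj]
      ring
    omega
  -- The four classes modulo 100 are precisely `4 ∣ k` with `k ≡ 3` modulo 5 and `k ≢ 3` modulo 25,
  -- so both obstructions apply.
  have h0 := C.even_card_two_cycles hsym hc e he (by omega) hv (by omega) (by omega) (by omega)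
  have h1 := C.odd_card_two_cycles hsym hc e he (by omega) hv (by omega) hv4
  omega
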